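/- Let $N$ be a positive integer. There exist positive constants $c_5=c_5(N,p,q)$, $c_6=c_6(N,q)$ and $c_7=c_7(N,p)$, defined for all real $p,q$ with $1<q<\min\{p,2\}$ and depending only on the indicated quantities, such that the following holds. Let $1<q<\min\{p,2\}$, let $M\in\mathbb R$, let $\Omega\subset\mathbb R^N$ be a domain (a nonempty connected open set, not necessarily bounded) with $0\in\partial\Omega$, and let $u\in C^1(\overline\Omega\setminus\{0\})$ (that is, $u$ is continuous on $\overline\Omega\setminus\{0\}$ and $C^1$ in $\Omega$, and $\nabla u$ extends continuously to $\overline\Omega\setminus\{0\}$) be a solution, in the sense of distributions in $\Omega$, of $$-\Delta u+|u|^{p-1}u-M|\nabla u|^q=0 ,$$ with $u=0$ on $\partial\Omega\setminus\{0\}$. Write $u_+=\max\{u,0\}$. 1. If $M>0$, then $$u_+(x)\le c_5\max\left\{M^{\frac1{p-q}}|x|^{-\frac q{p-q}},\ |x|^{-\frac2{p-1}}\right\}\qquad\text{for all }x\in\Omega .$$ 2. If $M\le 0$, then $$u_+(x)\le \min\left\{c_6|M|^{-\frac1{q-1}}|x|^{-\frac{2-q}{q-1}},\ c_7|x|^{-\frac2{p-1}}\right\}\qquad\text{for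 all }x\in\Omega ,$$ where for $M=0$ the first term in the minimum is understood as $+\infty$, so that the estimate reads $u_+(x)\le c_7|x|^{-\frac2{p-1}}$. -/

import Mathlib

open scoped ContDiff Laplacian Gradient

/-- `u ∈ C¹(A̅ ∖ {0})` for an open set `A`: `u` is `C¹` in `A`, continuous on `A̅ ∖ {0}`,
and `∇u` extends continuously from `A` to `A̅ ∖ {0}`. -/
def IsC1OffOrigin {N : ℕ} (A : Set (EuclideanSpace ℝ (Fin N)))
    (u : EuclideanSpace ℝ (Fin N) → ℝ) : Prop :=
  ContDiffOn ℝ 1 u A ∧ ContinuousOn u (closure A \ {0}) ∧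
    ∃ G : EuclideanSpace ℝ (Fin N) → EuclideanSpace ℝ (Fin N),
      ContinuousOn G (closure A \ {0}) ∧ ∀ x ∈ A, G x = ∇ u x

/-- `-Δu + |u|^{p-1} u - M |∇u|^q = 0` in the sense of distributions in the open set `A`
(for `u` of class `C¹` in `A`). -/
def SolvesInDistributions {N : ℕ} (p q M : ℝ) (A : Set (EuclideanSpace ℝ (Fin N)))
    (u : EuclideanSpace ℝ (Fin N) → ℝ) : Prop :=
  ∀ φ : EuclideanSpace ℝ (Fin N) → ℝ,
    ContDiff ℝ ∞ φ → HasCompactSupport φ → tsupport φ ⊆ A →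
      ∫ x in A, (-(u x * Δ φ x) + (|u x| ^ (p - 1) * u x - M * ‖∇ u x‖ ^ q) * φ x) = 0

open Set Filter Topology MeasureTheory Metric InnerProductSpace

local notation "E^" N => EuclideanSpace ℝ (Fin N)

/-! The proof is a Keller–Osserman comparison with explicit barriers. Although `u` is only `C¹` and
solves the equation weakly, mollification shows that it is a viscosity subsolution
(`le_laplacian_of_isLocalMax_sub`): at a local maximum of `u - w` with `w` of class `C²`, the
equation may be tested on `w`. There `∇u = ∇w`, so the gradient terms of `u` and of a supersolution
`w` cancel, and what remains is `u ^ p ≤ w ^ p`, impossible where `u > w > 0`. This is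
`le_of_supersolution`; the zero boundary values of `u` exclude maxima on the boundary of the domain.

Two barriers give the estimates. On the ball of radius `|x₀| / 2` about `x₀`, a power of `1 - |x -
x₀|² / r²` blows up at the sphere, so no boundary information is needed, and its value at the centre
bounds `u x₀`; this gives the bound for `M > 0` and the absorption bound for `M ≤ 0`. For `M < 0`,
the function `C (|x| - δ)^(-α) + δ` is a supersolution because of the gradient term alone. It
dominates `u` near the sphere of radius `δ` by blow-up and far away by the absorption bound, which
makes `u` small there; then `δ → 0`. -/

/-! ### Laplacians at maxima and under mollification. -/

theorem laplacian_eq_sum_fderiv_fderiv {N : ℕ} {g : (E^ N) → ℝ} {x : E^ N}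
    (hg : ContDiffAt ℝ 2 g x) :
    Δ g x = ∑ i, fderiv ℝ (fun y => fderiv ℝ g y (EuclideanSpace.basisFun (Fin N) ℝ i)) x
      (EuclideanSpace.basisFun (Fin N) ℝ i) := by
  rw [laplacian_eq_iteratedFDeriv_orthonormalBasis g (EuclideanSpace.basisFun (Fin N) ℝ)]
  refine Finset.sum_congr rfl fun i _ => ?_
  have h1 : DifferentiableAt ℝ (fderiv ℝ g) x :=
    (hg.fderiv_right (m := 1) (by norm_num)).differentiableAt (by norm_num)
  rw [iteratedFDeriv_two_apply, fderiv_clm_apply h1 (differentiableAt_const _)]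
  simp

theorem continuousAt_laplacian {N : ℕ} {g : (E^ N) → ℝ} {x : E^ N}
    (hg : ContDiffAt ℝ 2 g x) : ContinuousAt (Δ g) x := by
  rw [laplacian_eq_iteratedFDeriv_orthonormalBasis g (EuclideanSpace.basisFun (Fin N) ℝ)]
  have h : ContinuousAt (iteratedFDeriv ℝ 2 g) x :=
    (hg.iteratedFDeriv_right (m := 0) (i := 2) (by norm_num)).continuousAt
  refine tendsto_finsetSum _ fun i _ => ?_
  exact ((ContinuousMultilinearMap.apply ℝ _ ℝ _).continuous.continuousAt
    (x := iteratedFDeriv ℝ 2 g x)).comp h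

/-- At a local maximum the second derivative of a function of one variable is not positive. -/
theorem deriv_deriv_nonpos_of_isLocalMax {g : ℝ → ℝ} {t : ℝ} (hg : ContinuousAt g t)
    (hmax : IsLocalMax g t) : deriv (deriv g) t ≤ 0 := by
  -- A positive second derivative would make `t` a local minimum too, hence `g` locally constant.
  by_contra! h
  have hmin := isLocalMin_of_deriv_deriv_pos h hmax.deriv_eq_zero hg
  have hc : g =ᶠ[𝓝 t] fun _ => g t := by
    filter_upwards [hmin, hmax] with s h1 h2 using le_antisymm h2 h1
  have : deriv (deriv g) t = 0 := by
    rw [hc.deriv.deriv_eq]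
    simp
  linarith

/-- At a local maximum the Laplacian of a `C²` function is not positive. -/
theorem laplacian_nonpos_of_isLocalMax {N : ℕ} {g : (E^ N) → ℝ} {x : E^ N}
    (hg : ContDiffAt ℝ 2 g x) (hmax : IsLocalMax g x) : Δ g x ≤ 0 := by
  rw [laplacian_eq_sum_fderiv_fderiv hg]
  refine Finset.sum_nonpos fun i _ => ?_
  set e := EuclideanSpace.basisFun (Fin N) ℝ i
  set ℓ : ℝ → E^ N := fun t => x + t • e with hℓ
  have hℓd : ∀ t, HasDerivAt ℓ e t := fun t => by
    have : HasDerivAt (fun s : ℝ => s • e) e t := by simpa using (hasDerivAt_id t).smul_const e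
    exact this.const_add x
  have hℓ0 : ℓ 0 = x := by simp [hℓ]
  have hℓt : Tendsto ℓ (𝓝 0) (𝓝 x) := by
    have := (hℓd 0).continuousAt.tendsto
    rwa [hℓ0] at this
  have hev : ∀ᶠ y in 𝓝 x, DifferentiableAt ℝ g y :=
    (hg.eventually (by simp)).mono fun y hy => hy.differentiableAt (by norm_num)
  have h1 : deriv (g ∘ ℓ) =ᶠ[𝓝 0] (fun y => fderiv ℝ g y e) ∘ ℓ := by
    filter_upwards [hℓt.eventually hev] with t ht
    exact (ht.hasFDerivAt.comp_hasDerivAt t (hℓd t)).deriv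
  have h2 : DifferentiableAt ℝ (fun y => fderiv ℝ g y e) x :=
    ((hg.fderiv_right (m := 1) (by norm_num)).differentiableAt (by norm_num)).clm_apply
      (differentiableAt_const _)
  have h3 : deriv (deriv (g ∘ ℓ)) 0 = fderiv ℝ (fun y => fderiv ℝ g y e) x e := by
    rw [h1.deriv_eq]
    have := h2.hasFDerivAt
    rw [← hℓ0] at this
    rw [(this.comp_hasDerivAt 0 (hℓd 0)).deriv, hℓ0]
  rw [← h3]
  refine deriv_deriv_nonpos_of_isLocalMax ?_ ?_
  · have := hg.continuousAt
    rw [← hℓ0] at this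
    exact this.comp (hℓd 0).continuousAt
  · have h4 := hℓt.eventually hmax
    filter_upwards [h4] with t ht
    simpa [hℓ0] using ht

/-- The Laplacian of a mollification falls on the mollifier. -/
theorem laplacian_convolution {N : ℕ} {g η : (E^ N) → ℝ} (hg : LocallyIntegrable g)
    (hη : ContDiff ℝ ∞ η) (hηc : HasCompactSupport η) (x : E^ N) :
    Δ (convolution g η (ContinuousLinearMap.lsmul ℝ ℝ) volume) x
      = ∫ y, g y * Δ η (x - y) := by
  set L := ContinuousLinearMap.lsmul ℝ ℝ (E := ℝ)
  have key : ∀ (ψ : (E^ N) → ℝ), ContDiff ℝ ∞ ψ → HasCompactSupport ψ → ∀ e y : E^ N,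
      fderiv ℝ (convolution g ψ L volume) y e
        = convolution g (fun z => fderiv ℝ ψ z e) L volume y := by
    intro ψ hψ hψc e y
    rw [(hψc.hasFDerivAt_convolution_right L hg (hψ.of_le (by simp)) y).fderiv]
    exact convolution_precompR_apply L hg (hψc.fderiv ℝ)
      (hψ.continuous_fderiv (by simp)) y e
  have hsm : ∀ (ψ : (E^ N) → ℝ), ContDiff ℝ ∞ ψ → ∀ e : E^ N,
      ContDiff ℝ ∞ (fun z => fderiv ℝ ψ z e) := fun ψ hψ e =>
    (hψ.fderiv_right (m := ∞) (by simp)).clm_apply contDiff_const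
  have hcs : ∀ (ψ : (E^ N) → ℝ), HasCompactSupport ψ → ∀ e : E^ N,
      HasCompactSupport (fun z => fderiv ℝ ψ z e) := fun ψ hψ e => hψ.fderiv_apply ℝ e
  have hC : ContDiff ℝ ∞ (convolution g η L volume) :=
    hηc.contDiff_convolution_right L hg hη
  rw [laplacian_eq_sum_fderiv_fderiv (contDiff_infty.1 hC 2).contDiffAt]
  have hΔ : ∀ z, Δ η z = ∑ i,
      fderiv ℝ (fun y => fderiv ℝ η y (EuclideanSpace.basisFun (Fin N) ℝ i)) z
        (EuclideanSpace.basisFun (Fin N) ℝ i) := fun z =>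
    laplacian_eq_sum_fderiv_fderiv (contDiff_infty.1 hη 2).contDiffAt
  simp_rw [hΔ, Finset.mul_sum]
  rw [integral_finsetSum]
  · refine Finset.sum_congr rfl fun i _ => ?_
    set e := EuclideanSpace.basisFun (Fin N) ℝ i
    have : (fun y => fderiv ℝ (convolution g η L volume) y e)
        = convolution g (fun z => fderiv ℝ η z e) L volume := funext fun y => key η hη hηc e y
    rw [this, key _ (hsm η hη e) (hcs η hηc e)]
    rfl
  · intro i _
    set e := EuclideanSpace.basisFun (Fin N) ℝ i
    exact (hcs _ (hcs η hηc e) e).convolutionExists_right L hg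
      (hsm _ (hsm η hη e) e).continuous x

theorem laplacian_comp_const_sub {N : ℕ} {η : (E^ N) → ℝ} (hη : ContDiff ℝ 2 η) (z y : E^ N) :
    Δ (fun y => η (z - y)) y = Δ η (z - y) := by
  have hsub : ∀ y : E^ N, HasFDerivAt (fun y => z - y) (-ContinuousLinearMap.id ℝ (E^ N)) y :=
    fun y => (hasFDerivAt_id y).const_sub z
  have key : ∀ (ψ : (E^ N) → ℝ), Differentiable ℝ ψ → ∀ y e,
      fderiv ℝ (fun y => ψ (z - y)) y e = -fderiv ℝ ψ (z - y) e := by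
    intro ψ hψ y e
    have := ((hψ (z - y)).hasFDerivAt.comp y (hsub y)).fderiv
    rw [Function.comp_def] at this
    rw [this]
    simp
  have hc : ContDiff ℝ 2 (fun y => η (z - y)) := hη.comp (contDiff_const.sub contDiff_id)
  rw [laplacian_eq_sum_fderiv_fderiv hc.contDiffAt, laplacian_eq_sum_fderiv_fderiv hη.contDiffAt]
  refine Finset.sum_congr rfl fun i _ => ?_
  set e := EuclideanSpace.basisFun (Fin N) ℝ i
  have h1 : Differentiable ℝ (fun y => fderiv ℝ η y e) :=
    ((hη.fderiv_right (m := 1) (by norm_num)).differentiable (by norm_num)).clm_apply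
      (differentiable_const _)
  simp_rw [key η (hη.differentiable (by norm_num))]
  rw [fderiv_fun_neg, neg_apply, key _ h1, neg_neg]

/-! ### Derivatives of radial functions. -/

section Radial

variable {N : ℕ} {h h₁ : ℝ → ℝ} {a x : E^ N}

/-- Profiles are functions of the squared distance, so that smoothness at the centre `a` needs no
separate argument. -/
theorem hasFDerivAt_radial {d : ℝ} (hd : HasDerivAt h d (‖x - a‖ ^ 2)) :
    HasFDerivAt (fun y => h (‖y - a‖ ^ 2)) ((2 * d) • innerSL ℝ (x - a)) x := by
  have h0 : HasFDerivAt (fun y : E^ N => ‖y - a‖ ^ 2) (2 • innerSL ℝ (x - a)) x := by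
    exact ((hasStrictFDerivAt_norm_sq (x - a)).hasFDerivAt.comp x
      ((hasFDerivAt_id x).sub_const a)).congr_fderiv (ContinuousLinearMap.comp_id _)
  refine (hd.comp_hasFDerivAt x h0).congr_fderiv ?_
  ext v
  simp
  ring

theorem gradient_radial {d : ℝ} (hd : HasDerivAt h d (‖x - a‖ ^ 2)) :
    ∇ (fun y => h (‖y - a‖ ^ 2)) x = (2 * d) • (x - a) := by
  have h0 : HasGradientAt (fun y => h (‖y - a‖ ^ 2)) ((2 * d) • (x - a)) x := by
    rw [hasGradientAt_iff_hasFDerivAt]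
    refine (hasFDerivAt_radial hd).congr_fderiv ?_
    ext v
    simp
  exact h0.gradient

theorem contDiffAt_radial (hh : ContDiffAt ℝ 2 h (‖x - a‖ ^ 2)) :
    ContDiffAt ℝ 2 (fun y => h (‖y - a‖ ^ 2)) x :=
  ContDiffAt.comp (f := fun y : E^ N => ‖y - a‖ ^ 2) x hh
    ((contDiff_id.sub contDiff_const).norm_sq ℝ).contDiffAt

theorem laplacian_radial {d : ℝ} (hh : ContDiffAt ℝ 2 h (‖x - a‖ ^ 2))
    (hd : ∀ᶠ s in 𝓝 (‖x - a‖ ^ 2), HasDerivAt h (h₁ s) s)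
    (hd₁ : HasDerivAt h₁ d (‖x - a‖ ^ 2)) :
    Δ (fun y => h (‖y - a‖ ^ 2)) x = 4 * d * ‖x - a‖ ^ 2 + 2 * N * h₁ (‖x - a‖ ^ 2) := by
  rw [laplacian_eq_sum_fderiv_fderiv (contDiffAt_radial hh)]
  have hcont : Tendsto (fun y : E^ N => ‖y - a‖ ^ 2) (𝓝 x) (𝓝 (‖x - a‖ ^ 2)) := by
    have : Continuous (fun y : E^ N => ‖y - a‖ ^ 2) := by fun_prop
    exact this.tendsto x
  have hterm : ∀ i, fderiv ℝ (fun y => fderiv ℝ (fun y => h (‖y - a‖ ^ 2)) y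
      (EuclideanSpace.basisFun (Fin N) ℝ i)) x (EuclideanSpace.basisFun (Fin N) ℝ i)
      = 4 * d * ((x - a) i) ^ 2 + 2 * h₁ (‖x - a‖ ^ 2) := by
    intro i
    set e := EuclideanSpace.basisFun (Fin N) ℝ i with he
    have hi : ∀ v : E^ N, inner ℝ v e = v i := fun v => by
      simp [he, EuclideanSpace.inner_single_right]
    have hev : (fun y => fderiv ℝ (fun y => h (‖y - a‖ ^ 2)) y e)
        =ᶠ[𝓝 x] fun y => 2 * h₁ (‖y - a‖ ^ 2) * inner ℝ (y - a) e := by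
      filter_upwards [hcont.eventually hd] with y hy
      rw [(hasFDerivAt_radial hy).fderiv]
      simp [inner_sub_left]
    rw [hev.fderiv_eq]
    have hA := (hasFDerivAt_radial hd₁).const_mul 2
    have hB : HasFDerivAt (fun y : E^ N => inner ℝ (y - a) e) (innerSL ℝ e) x := by
      have := ((innerSL ℝ e).hasFDerivAt (x := x - a)).comp x ((hasFDerivAt_id x).sub_const a)
      refine (this.congr_fderiv (by ext; simp)).congr_of_eventuallyEq ?_
      exact Eventually.of_forall fun y => by simp [real_inner_comm]
    rw [(hA.fun_mul hB).fderiv]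
    have hee : ‖e‖ = 1 := OrthonormalBasis.norm_eq_one _ i
    simp [hi, hee, -EuclideanSpace.basisFun_apply]
    ring
  rw [Finset.sum_congr rfl fun i _ => hterm i, Finset.sum_add_distrib, ← Finset.mul_sum,
    EuclideanSpace.norm_sq_eq]
  simp
  ring

end Radial

/-! ### From distributional solutions to viscosity subsolutions. -/

/-- A continuous distributional solution of `Δ u = f` is a viscosity subsolution: if a `C²`
function `w` touches `u` from above at `x₁`, up to a constant, then `f x₁ ≤ Δ w x₁`. -/
theorem le_laplacian_of_isLocalMax_sub {N : ℕ} {U : Set (E^ N)} (hU : IsOpen U)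
    {u f w : (E^ N) → ℝ} {x₁ : E^ N} (hu : ContinuousOn u U) (hf : ContinuousOn f U)
    (hdist : ∀ φ : (E^ N) → ℝ, ContDiff ℝ ∞ φ → HasCompactSupport φ → tsupport φ ⊆ U →
      ∫ x in U, (-(u x * Δ φ x) + f x * φ x) = 0)
    (hx₁ : x₁ ∈ U) (hw : ContDiffAt ℝ 2 w x₁) (hmax : IsLocalMax (fun x => u x - w x) x₁) :
    f x₁ ≤ Δ w x₁ := by
  by_contra! hlt
  -- Adding `δ |x - x₁|²` to `w` makes the maximum strict and costs `2Nδ` in the Laplacian, at most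
  -- half the gap. The `+ 1` in the denominator covers `N = 0`.
  obtain ⟨δ, hδ, hδlt⟩ : ∃ δ : ℝ, 0 < δ ∧ Δ w x₁ + δ * (2 * N) < f x₁ := by
    refine ⟨(f x₁ - Δ w x₁) / (2 * (2 * N + 1)), div_pos (by linarith) (by positivity), ?_⟩
    have h1 : (f x₁ - Δ w x₁) / (2 * (2 * N + 1)) * (2 * N) ≤ (f x₁ - Δ w x₁) / 2 := by
      rw [div_mul_eq_mul_div, div_le_div_iff₀ (by positivity) (by norm_num)]
      nlinarith
    linarith
  set Q : (E^ N) → ℝ := fun x => ‖x - x₁‖ ^ 2 with hQ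
  have hQc : ∀ x, ContDiffAt ℝ 2 Q x := fun x =>
    contDiffAt_radial (h := fun s => s) contDiffAt_id
  have hQΔ : Δ Q x₁ = 2 * N := by
    have := laplacian_radial (h := fun s => s) (h₁ := fun _ => 1) (a := x₁) (x := x₁) (d := 0)
      contDiffAt_id (Eventually.of_forall fun s => hasDerivAt_id s) (hasDerivAt_const _ _)
    simpa using this
  set W : (E^ N) → ℝ := w + δ • Q with hW
  have hδQ : ContDiffAt ℝ 2 (δ • Q) x₁ := (hQc x₁).const_smul δ
  have hWc : ContDiffAt ℝ 2 W x₁ := hw.add hδQ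
  have hWΔ : Δ W x₁ < f x₁ := by
    rw [hW, hw.laplacian_add hδQ, laplacian_smul δ (hQc x₁), hQΔ]
    exact hδlt
  obtain ⟨m, hm1, hm2⟩ := exists_between hWΔ
  have hev : ∀ᶠ x in 𝓝 x₁, x ∈ U ∧ ContDiffAt ℝ 2 W x ∧ Δ W x < m ∧ m < f x ∧
      u x - w x ≤ u x₁ - w x₁ := by
    filter_upwards [hU.mem_nhds hx₁, hWc.eventually (by simp),
      (continuousAt_laplacian hWc).eventually_lt continuousAt_const hm1,
      continuousAt_const.eventually_lt (hf.continuousAt (hU.mem_nhds hx₁)) hm2, hmax]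
      with x h1 h2 h3 h4 h5 using ⟨h1, h2, h3, h4, h5⟩
  obtain ⟨r, hr, hball⟩ := Metric.eventually_nhds_iff_ball.1 hev
  -- Room for the cutoff, which is `1` on radius `2ρ` and vanishes outside radius `3ρ < r`.
  -- Mollifying at scale `s < ρ` at a point of the `ρ`-ball then sees only the region where the
  -- cutoff is `1`.
  set ρ := r / 4 with hρ
  have hρ0 : 0 < ρ := by positivity
  let χ : ContDiffBump x₁ := ⟨2 * ρ, 3 * ρ, by positivity, by linarith⟩
  have hχU : tsupport χ ⊆ U := by
    rw [χ.tsupport_eq]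
    intro y hy
    refine (hball y ?_).1
    have : dist y x₁ ≤ 3 * ρ := hy
    rw [mem_ball]; linarith
  have hχ1 : ∀ y, dist y x₁ ≤ 2 * ρ → χ y = 1 := fun y hy => χ.one_of_mem_closedBall hy
  have hcut : ∀ g : (E^ N) → ℝ, ContinuousOn g U →
      Continuous (fun x => χ x * g x) ∧ HasCompactSupport (fun x => χ x * g x) := by
    intro g hg
    refine ⟨ContinuousOn.continuous_of_tsupport_subset (χ.continuous.continuousOn.mul hg) hU
      ((tsupport_mul_subset_left).trans hχU), χ.hasCompactSupport.mul_right⟩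
  set v : (E^ N) → ℝ := fun x => χ x * u x with hv
  obtain ⟨hvc, hvs⟩ := hcut u hu
  obtain ⟨hfc, hfs⟩ := hcut f hf
  -- The penalty is `δρ²` on the sphere of radius `ρ`. Mollification errors of a third of it at `x₁`
  -- and at `z` cannot move the maximum onto that sphere.
  obtain ⟨s₀, hs₀, hunif⟩ := Metric.uniformContinuous_iff.1
    (hvs.uniformContinuous_of_continuous hvc) (δ * ρ ^ 2 / 3) (by positivity)
  set s := min s₀ (ρ / 2) with hs
  have hs0 : 0 < s := lt_min hs₀ (by positivity)
  have hsρ : s < ρ := (min_le_right _ _).trans_lt (by linarith)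
  let b : ContDiffBump (0 : E^ N) := ⟨s / 2, s, by positivity, by linarith⟩
  set η := b.normed volume with hη
  have hηs : ContDiff ℝ ∞ η := b.contDiff_normed
  have hηc : HasCompactSupport η := b.hasCompactSupport_normed
  set V := convolution v η (ContinuousLinearMap.lsmul ℝ ℝ) volume with hV
  have hVv : ∀ x, dist (V x) (v x) ≤ δ * ρ ^ 2 / 3 := by
    intro x
    have hflip : V = convolution η v (ContinuousLinearMap.lsmul ℝ ℝ) volume := by
      rw [hV, ← convolution_flip]
      congr 1
      ext
      simp
    rw [hflip]
    refine b.dist_normed_convolution_le hvc.aestronglyMeasurable fun y hy => ?_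
    exact (hunif (lt_of_lt_of_le (mem_ball.1 hy) (min_le_left _ _))).le
  have hVc : ContDiff ℝ 2 V :=
    contDiff_infty.1 (hηc.contDiff_convolution_right _ hvc.locallyIntegrable hηs) 2
  have hin : ∀ {y}, dist y x₁ ≤ ρ → y ∈ ball x₁ r := fun {y} hy => by
    rw [mem_ball]; linarith
  have hcontVW : ContinuousOn (fun x => V x - W x) (closedBall x₁ ρ) := fun y hy =>
    (hVc.continuous.continuousAt.sub
      (hball y (hin hy)).2.1.continuousAt).continuousWithinAt
  obtain ⟨z, hz, hzmax⟩ := (isCompact_closedBall x₁ ρ).exists_isMaxOn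
    ⟨x₁, mem_closedBall_self hρ0.le⟩ hcontVW
  have hzlt : dist z x₁ < ρ := by
    refine lt_of_le_of_ne hz fun heq => ?_
    have h1 : V x₁ - W x₁ ≤ V z - W z := hzmax (mem_closedBall_self hρ0.le)
    have h2 := abs_le.1 (hVv x₁)
    have h3 := abs_le.1 (hVv z)
    have h4 : v x₁ = u x₁ := by simp [hv, hχ1 x₁ (by simp; positivity)]
    have h5 : v z = u z := by simp [hv, hχ1 z (by linarith)]
    have h6 : W x₁ = w x₁ := by simp [hW, hQ]
    have h7 : W z = w z + δ * ρ ^ 2 := by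
      simp [hW, hQ, ← dist_eq_norm, heq]
    have h8 := (hball z (hin hz)).2.2.2.2
    have h9 : 0 < δ * ρ ^ 2 := by positivity
    rw [h4] at h2
    rw [h5] at h3
    rw [h6, h7] at h1
    linarith [h2.1, h3.2]
  have hzloc : IsLocalMax (V - W) z :=
    hzmax.isLocalMax (mem_of_superset (isOpen_ball.mem_nhds hzlt) ball_subset_closedBall)
  have hzW := (hball z (hin hz)).2.1
  have hzΔW := (hball z (hin hz)).2.2.1
  have hΔle : Δ V z ≤ Δ W z := by
    have := laplacian_nonpos_of_isLocalMax (g := V - W) (hVc.contDiffAt.sub hzW) hzloc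
    rw [hVc.contDiffAt.laplacian_sub hzW] at this
    linarith
  have hΔV : Δ V z = ∫ y, v y * Δ η (z - y) :=
    laplacian_convolution hvc.locallyIntegrable hηs hηc z
  -- Testing the equation with the reflected mollifier turns `Δ V z` into an average of `f` near
  -- `x₁`, which is at least `m`, whereas `Δ V z ≤ Δ W z < m`.
  set φ : (E^ N) → ℝ := fun y => η (z - y) with hφ
  have hφΔ : ∀ y, Δ φ y = Δ η (z - y) := laplacian_comp_const_sub (contDiff_infty.1 hηs 2) z
  have hφs : ContDiff ℝ ∞ φ := hηs.comp (contDiff_const.sub contDiff_id)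
  have hφc : HasCompactSupport φ := hηc.comp_homeomorph (Homeomorph.subLeft z)
  have hφt : tsupport φ ⊆ closedBall x₁ (2 * ρ) := by
    have h1 : tsupport φ = (Homeomorph.subLeft z) ⁻¹' tsupport η :=
      tsupport_comp_eq_preimage η (Homeomorph.subLeft z)
    rw [h1, hη, b.tsupport_normed_eq]
    intro y hy
    have h2 : dist y z ≤ s := by
      have : dist (z - y) 0 ≤ s := hy
      rwa [dist_zero_right, ← dist_eq_norm, dist_comm] at this
    have := dist_triangle y z x₁
    rw [mem_closedBall]; linarith
  have hφU : tsupport φ ⊆ U := fun y hy => by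
    have h1 : dist y x₁ ≤ 2 * ρ := hφt hy
    refine (hball y ?_).1
    rw [mem_ball]; linarith
  have hΔ0 : ∀ y ∉ tsupport φ, Δ φ y = 0 := by
    intro y hy
    have h1 : φ =ᶠ[𝓝 y] fun _ => (0 : ℝ) := notMem_tsupport_iff_eventuallyEq.1 hy
    rw [(laplacian_congr_nhds h1).eq_of_nhds]
    simp
  have hφ0 : ∀ y ∉ tsupport φ, φ y = 0 := fun y hy => image_eq_zero_of_notMem_tsupport hy
  have hweak := hdist φ hφs hφc hφU
  have hcongr : (fun x => -(u x * Δ φ x) + f x * φ x)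
      = fun x => -(v x * Δ φ x) + χ x * f x * φ x := by
    funext y
    by_cases hy : y ∈ tsupport φ
    · simp [hv, hχ1 y (hφt hy)]
    · simp [hΔ0 y hy, hφ0 y hy]
  rw [setIntegral_eq_integral_of_forall_compl_eq_zero (fun y hy => by
    simp [hΔ0 y (fun h => hy (hφU h)), hφ0 y (fun h => hy (hφU h))]), hcongr] at hweak
  have hΔφc : Continuous (Δ φ) := continuous_iff_continuousAt.2 fun y =>
    continuousAt_laplacian (contDiff_infty.1 hφs 2).contDiffAt
  have hi1 : Integrable (fun x => v x * Δ φ x) :=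
    (hvc.mul hΔφc).integrable_of_hasCompactSupport hvs.mul_right
  have hi2 : Integrable (fun x => χ x * f x * φ x) :=
    (hfc.mul hφs.continuous).integrable_of_hasCompactSupport hfs.mul_right
  rw [integral_add (f := fun x => -(v x * Δ φ x)) hi1.neg hi2, integral_neg] at hweak
  have hφint : ∫ y, φ y = 1 := by
    rw [hφ, integral_sub_left_eq_self η volume z]
    exact b.integral_normed
  have hge : m ≤ ∫ x, χ x * f x * φ x := by
    have h1 : ∫ x, m * φ x ≤ ∫ x, χ x * f x * φ x := by
      refine integral_mono ((hφs.continuous.integrable_of_hasCompactSupport hφc).const_mul m)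
        hi2 fun y => ?_
      by_cases hy : y ∈ tsupport φ
      · have h2 : dist y x₁ ≤ 2 * ρ := hφt hy
        have h3 : m < f y := (hball y (by rw [mem_ball]; linarith)).2.2.2.1
        have h4 : 0 ≤ φ y := b.nonneg_normed _
        simp only [hχ1 y h2, one_mul]
        exact mul_le_mul_of_nonneg_right h3.le h4
      · simp [hφ0 y hy]
    rwa [integral_const_mul, hφint, mul_one] at h1
  simp_rw [hφΔ] at hweak
  linarith

/-! ### Comparison principle. -/

theorem ContDiffOn.continuousOn_gradient {N : ℕ} {A : Set (E^ N)} {u : (E^ N) → ℝ}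
    (hu : ContDiffOn ℝ 1 u A) (hA : IsOpen A) : ContinuousOn (∇ u) A :=
  (toDual ℝ (E^ N)).symm.continuous.comp_continuousOn
    (hu.continuousOn_fderiv_of_isOpen hA le_rfl)

/-- Since `u` is `C¹`, the lower-order terms form a continuous right-hand side, and at the maximum
the gradients of `u` and `w` coincide. -/
theorem SolvesInDistributions.le_laplacian {N : ℕ} {p q M : ℝ} {A : Set (E^ N)}
    {u w : (E^ N) → ℝ} {x₁ : E^ N} (hsol : SolvesInDistributions p q M A u) (hA : IsOpen A)
    (hu : ContDiffOn ℝ 1 u A) (hp : 1 ≤ p) (hq : 0 ≤ q) (hx₁ : x₁ ∈ A)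
    (hw : ContDiffAt ℝ 2 w x₁) (hmax : IsLocalMax (fun x => u x - w x) x₁) :
    |u x₁| ^ (p - 1) * u x₁ - M * ‖∇ w x₁‖ ^ q ≤ Δ w x₁ := by
  have hgrad : ∇ u x₁ = ∇ w x₁ := by
    have hud : DifferentiableAt ℝ u x₁ :=
      (hu.contDiffAt (hA.mem_nhds hx₁)).differentiableAt (by norm_num)
    have h1 := hmax.fderiv_eq_zero
    rw [fderiv_fun_sub hud (hw.differentiableAt (by norm_num))] at h1
    simp only [gradient, sub_eq_zero.1 h1]
  rw [← hgrad]
  refine le_laplacian_of_isLocalMax_sub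
    (f := fun x => |u x| ^ (p - 1) * u x - M * ‖∇ u x‖ ^ q) hA hu.continuousOn ?_ hsol hx₁ hw hmax
  exact ((hu.continuousOn.abs.rpow_const fun x _ => Or.inr (by linarith)).mul
    hu.continuousOn).sub (continuousOn_const.mul
      ((hu.continuousOn_gradient hA).norm.rpow_const fun x _ => Or.inr hq))

/-- Comparison with a classical supersolution `w` on a compact set avoiding the origin. -/
theorem SolvesInDistributions.le_of_supersolution {N : ℕ} {p q M : ℝ} {A K : Set (E^ N)}
    {u w : (E^ N) → ℝ} (hsol : SolvesInDistributions p q M A u) (hA : IsOpen A)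
    (hu : IsC1OffOrigin A u) (hbd : ∀ x ∈ frontier A \ {0}, u x = 0)
    (hp : 1 < p) (hq : 0 ≤ q) (hK : IsCompact K) (hK0 : 0 ∉ K)
    (hw : ∀ x ∈ K, ContDiffAt ℝ 2 w x) (hwpos : ∀ x ∈ K, 0 < w x)
    (hsuper : ∀ x ∈ K, Δ w x ≤ w x ^ p - M * ‖∇ w x‖ ^ q)
    (hKbd : ∀ x ∈ K, x ∈ A → x ∉ interior K → u x ≤ w x) :
    ∀ x ∈ K, x ∈ A → u x ≤ w x := by
  intro y hyK hyA
  by_contra! hlt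
  have hcont : ContinuousOn (fun x => u x - w x) (K ∩ closure A) := by
    refine ContinuousOn.sub (hu.2.1.mono fun x hx => ⟨hx.2, fun h => hK0 ?_⟩) fun x hx =>
      (hw x hx.1).continuousAt.continuousWithinAt
    rw [← mem_singleton_iff.1 h]
    exact hx.1
  obtain ⟨z, ⟨hzK, hzA'⟩, hzmax⟩ := (hK.inter_right isClosed_closure).exists_isMaxOn
    ⟨y, hyK, subset_closure hyA⟩ hcont
  have hz : w z < u z := by
    have : u y - w y ≤ u z - w z := hzmax ⟨hyK, subset_closure hyA⟩
    linarith
  have hwz := hwpos z hzK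
  have hzA : z ∈ A := by
    by_contra hzA
    have h0 : u z = 0 := hbd z ⟨⟨hzA', fun h => hzA (interior_subset h)⟩, fun h => hK0 (by
      rw [← mem_singleton_iff.1 h]; exact hzK)⟩
    linarith
  have hzint : z ∈ interior K := by
    by_contra h
    linarith [hKbd z hzK hzA h]
  have hloc : IsLocalMax (fun x => u x - w x) z :=
    hzmax.isLocalMax (inter_mem (mem_interior_iff_mem_nhds.1 hzint)
      (mem_of_superset (hA.mem_nhds hzA) subset_closure))
  -- Both inequalities carry the same term `M * ‖∇ w z‖ ^ q`, whatever the sign of `M`; strict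
  -- monotonicity of the `p`-th power gives the contradiction.
  have h1 := hsol.le_laplacian hA hu.1 hp.le hq hzA (hw z hzK) hloc
  have h2 := hsuper z hzK
  have huz : 0 < u z := hwz.trans hz
  have h3 : |u z| ^ (p - 1) * u z = u z ^ p := by
    rw [abs_of_pos huz, ← Real.rpow_add_one huz.ne']
    congr 1
    ring
  have h4 : w z ^ p < u z ^ p := Real.rpow_lt_rpow hwz.le hz (by linarith)
  linarith

/-- Chooses how close to its singular sphere a barrier is cut off, so that it exceeds a known bound
for `u` there. -/
theorem exists_lt_le_mul_rpow_neg {k D : ℝ} (hk : 0 < k) (hD : 0 < D) (B : ℝ) {T : ℝ}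
    (hT : 0 < T) : ∃ t, 0 < t ∧ t < T ∧ B ≤ D * t ^ (-k) := by
  have h1 : Tendsto (fun t : ℝ => D * t ^ (-k)) (𝓝[>] 0) atTop :=
    (tendsto_rpow_neg_nhdsGT_zero (neg_lt_zero.2 hk)).const_mul_atTop hD
  obtain ⟨t, ht1, ht2, ht3⟩ := ((h1.eventually_ge_atTop B).and
    ((eventually_nhdsWithin_of_eventually_nhds (eventually_lt_nhds hT)).and
      self_mem_nhdsWithin)).exists
  exact ⟨t, ht3, ht2, ht1⟩

/-! ### The blow-up barrier on a ball. -/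

/-- The Keller-Osserman barrier `D (1 - |x - x₀|² / r²)^(-k)` on the ball of radius `r`. -/
noncomputable def ballBarrier {N : ℕ} (D k r : ℝ) (x₀ x : E^ N) : ℝ :=
  D * (1 - ‖x - x₀‖ ^ 2 / r ^ 2) ^ (-k)

section BallBarrier

variable {N : ℕ} {D k r : ℝ} {x₀ x : E^ N}

theorem hasDerivAt_one_sub_div_rpow (b : ℝ) {s : ℝ} (hs : 0 < 1 - s / r ^ 2) :
    HasDerivAt (fun s => (1 - s / r ^ 2) ^ b) (-b / r ^ 2 * (1 - s / r ^ 2) ^ (b - 1)) s := by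
  have h1 : HasDerivAt (fun s : ℝ => 1 - s / r ^ 2) (-(1 / r ^ 2)) s :=
    ((hasDerivAt_id s).div_const _).const_sub 1
  refine (h1.rpow_const (Or.inl hs.ne')).congr_deriv ?_
  ring

theorem one_sub_div_pos (hr : 0 < r) (hx : ‖x - x₀‖ < r) : 0 < 1 - ‖x - x₀‖ ^ 2 / r ^ 2 := by
  rw [sub_pos, div_lt_one (by positivity)]
  exact pow_lt_pow_left₀ hx (norm_nonneg _) two_ne_zero

theorem contDiffAt_ballBarrier (hr : 0 < r) (hx : ‖x - x₀‖ < r) :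
    ContDiffAt ℝ 2 (ballBarrier D k r x₀) x := by
  refine contDiffAt_radial (h := fun s => D * (1 - s / r ^ 2) ^ (-k)) ?_
  refine contDiffAt_const.mul (ContDiffAt.rpow_const_of_ne ?_ (one_sub_div_pos hr hx).ne')
  exact contDiffAt_const.sub (contDiffAt_id.div_const _)

theorem norm_gradient_ballBarrier_le (hr : 0 < r) (hD : 0 ≤ D) (hk : 0 ≤ k)
    (hx : ‖x - x₀‖ < r) :
    ‖∇ (ballBarrier D k r x₀) x‖ ≤
      2 * k * D / r * (1 - ‖x - x₀‖ ^ 2 / r ^ 2) ^ (-k - 1) := by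
  have hσ := one_sub_div_pos hr hx
  have hg := gradient_radial (h := fun s => D * (1 - s / r ^ 2) ^ (-k)) (a := x₀) (x := x)
    ((hasDerivAt_one_sub_div_rpow (-k) hσ).const_mul D)
  have hfun : ballBarrier D k r x₀ = fun y => D * (1 - ‖y - x₀‖ ^ 2 / r ^ 2) ^ (-k) := rfl
  rw [neg_neg] at hg
  rw [hfun, hg, norm_smul, Real.norm_of_nonneg (by positivity)]
  calc _ ≤ 2 * (D * (k / r ^ 2 * (1 - ‖x - x₀‖ ^ 2 / r ^ 2) ^ (-k - 1))) * r := by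
        gcongr
    _ = _ := by field_simp

theorem laplacian_ballBarrier_le (hr : 0 < r) (hD : 0 ≤ D) (hk : 0 ≤ k)
    (hx : ‖x - x₀‖ < r) :
    Δ (ballBarrier D k r x₀) x ≤ (2 * k * N + 4 * k * (k + 1)) * D / r ^ 2 *
      (1 - ‖x - x₀‖ ^ 2 / r ^ 2) ^ (-k - 2) := by
  have hσ := one_sub_div_pos hr hx
  have hl := laplacian_radial (h := fun s => D * (1 - s / r ^ 2) ^ (-k)) (a := x₀) (x := x)
    (h₁ := fun s => D * (-(-k) / r ^ 2 * (1 - s / r ^ 2) ^ (-k - 1)))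
    (contDiffAt_const.mul (ContDiffAt.rpow_const_of_ne
      (contDiffAt_const.sub (contDiffAt_id.div_const _)) hσ.ne'))
    (by
      have hcont : ContinuousAt (fun s : ℝ => 1 - s / r ^ 2) (‖x - x₀‖ ^ 2) := by fun_prop
      filter_upwards [continuousAt_const.eventually_lt hcont hσ] with s hs
      exact (hasDerivAt_one_sub_div_rpow (-k) hs).const_mul D)
    (((hasDerivAt_one_sub_div_rpow (-k - 1) hσ).const_mul _).const_mul D)
  have hfun : ballBarrier D k r x₀ = fun y => D * (1 - ‖y - x₀‖ ^ 2 / r ^ 2) ^ (-k) := rfl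
  rw [hfun, hl]
  set σ := 1 - ‖x - x₀‖ ^ 2 / r ^ 2 with hσdef
  have hσ1 : σ ≤ 1 := by
    have : 0 ≤ ‖x - x₀‖ ^ 2 / r ^ 2 := by positivity
    linarith
  have hmono : σ ^ (-k - 1) ≤ σ ^ (-k - 2) :=
    Real.rpow_le_rpow_of_exponent_ge hσ hσ1 (by linarith)
  have hxr : ‖x - x₀‖ ^ 2 ≤ r ^ 2 := by gcongr
  rw [show -k - 1 - 1 = -k - 2 by ring]
  calc _ ≤ 4 * (D * (-(-k) / r ^ 2 * (-(-k - 1) / r ^ 2 * σ ^ (-k - 2)))) * r ^ 2 +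
        2 * N * (D * (-(-k) / r ^ 2 * σ ^ (-k - 2))) := by
        rw [neg_neg, show -(-k - 1) = k + 1 by ring]
        gcongr
    _ = _ := by field_simp; ring

/-- With `σ = 1 - |x - x₀|² / r² ≤ 1`, the Laplacian, the gradient term and the absorption term have
orders `σ^(-k-2)`, `σ^(-(k+1)q)` and `σ^(-kp)`. The conditions on `k` make the last one dominate,
and `hDle` compares the coefficients. For `M ≤ 0` the gradient term only helps, whence `max M 0`. -/
theorem ballBarrier_supersolution {p q M : ℝ} (hr : 0 < r) (hD : 0 < D) (hk : 0 < k)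
    (hq : 0 ≤ q) (hkp : k + 2 ≤ k * p) (hkq : 0 < M → (k + 1) * q ≤ k * p)
    (hDle : (2 * k * N + 4 * k * (k + 1)) * D / r ^ 2 + max M 0 * (2 * k * D / r) ^ q ≤ D ^ p)
    (hx : ‖x - x₀‖ < r) :
    Δ (ballBarrier D k r x₀) x ≤
      ballBarrier D k r x₀ x ^ p - M * ‖∇ (ballBarrier D k r x₀) x‖ ^ q := by
  have hσ := one_sub_div_pos hr hx
  have hΔ := laplacian_ballBarrier_le hr hD.le hk.le hx
  have hG := norm_gradient_ballBarrier_le hr hD.le hk.le hx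
  have hw : ballBarrier D k r x₀ x = D * (1 - ‖x - x₀‖ ^ 2 / r ^ 2) ^ (-k) := rfl
  rw [hw]
  set σ := 1 - ‖x - x₀‖ ^ 2 / r ^ 2 with hσdef
  have hσ1 : σ ≤ 1 := by
    have : 0 ≤ ‖x - x₀‖ ^ 2 / r ^ 2 := by positivity
    linarith
  have hwp : (D * σ ^ (-k)) ^ p = D ^ p * σ ^ (-(k * p)) := by
    rw [Real.mul_rpow hD.le (by positivity), ← Real.rpow_mul hσ.le, neg_mul]
  have h1 : (2 * k * N + 4 * k * (k + 1)) * D / r ^ 2 * σ ^ (-k - 2) ≤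
      (2 * k * N + 4 * k * (k + 1)) * D / r ^ 2 * σ ^ (-(k * p)) := by
    refine mul_le_mul_of_nonneg_left ?_ (by positivity)
    exact Real.rpow_le_rpow_of_exponent_ge hσ hσ1 (by linarith)
  have h2 : M * ‖∇ (ballBarrier D k r x₀) x‖ ^ q ≤
      max M 0 * (2 * k * D / r) ^ q * σ ^ (-(k * p)) := by
    rcases le_or_gt M 0 with hM | hM
    · rw [max_eq_right hM, zero_mul, zero_mul]
      exact mul_nonpos_of_nonpos_of_nonneg hM (by positivity)
    · rw [max_eq_left hM.le, mul_assoc]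
      refine mul_le_mul_of_nonneg_left ?_ hM.le
      calc _ ≤ (2 * k * D / r * σ ^ (-k - 1)) ^ q := by gcongr
        _ = (2 * k * D / r) ^ q * σ ^ ((-k - 1) * q) := by
          rw [Real.mul_rpow (by positivity) (by positivity), ← Real.rpow_mul hσ.le]
        _ ≤ _ := by
          refine mul_le_mul_of_nonneg_left ?_ (by positivity)
          exact Real.rpow_le_rpow_of_exponent_ge hσ hσ1 (by linarith [hkq hM])
  have h3 := mul_le_mul_of_nonneg_right hDle (Real.rpow_nonneg hσ.le (-(k * p)))
  rw [add_mul] at h3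
  rw [hwp]
  linarith

end BallBarrier

/-- Interior upper bound at the centre of a ball whose closure avoids the origin. -/
theorem SolvesInDistributions.le_of_ball {N : ℕ} {p q M D k r : ℝ} {A : Set (E^ N)}
    {u : (E^ N) → ℝ} {x₀ : E^ N} (hsol : SolvesInDistributions p q M A u) (hA : IsOpen A)
    (hu : IsC1OffOrigin A u) (hbd : ∀ x ∈ frontier A \ {0}, u x = 0)
    (hp : 1 < p) (hq : 0 ≤ q) (hr : 0 < r) (hD : 0 < D) (hk : 0 < k)
    (hkp : k + 2 ≤ k * p) (hkq : 0 < M → (k + 1) * q ≤ k * p)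
    (hDle : (2 * k * N + 4 * k * (k + 1)) * D / r ^ 2 + max M 0 * (2 * k * D / r) ^ q ≤ D ^ p)
    (hx₀ : x₀ ∈ A) (h0 : r < ‖x₀‖) : u x₀ ≤ D := by
  have h0' : (0 : E^ N) ∉ closedBall x₀ r := fun h => by
    rw [mem_closedBall, dist_zero_left] at h
    linarith
  obtain ⟨B, hB⟩ : ∃ B, ∀ y ∈ closedBall x₀ r ∩ closure A, u y ≤ B := by
    obtain ⟨B, hB⟩ := ((isCompact_closedBall x₀ r).inter_right
      (isClosed_closure (s := A))).bddAbove_image (f := u)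
      (hu.2.1.mono fun y hy => ⟨hy.2, fun h => h0' (by
        rw [← mem_singleton_iff.1 h]; exact hy.1)⟩)
    exact ⟨B, fun y hy => hB (mem_image_of_mem u hy)⟩
  obtain ⟨t, ht0, ht1, htB⟩ := exists_lt_le_mul_rpow_neg hk hD B one_pos
  -- Chosen so that `1 - r'² / r² = t`: on the sphere of radius `r'` the barrier equals `D * t ^
  -- (-k)`.
  set r' := r * √(1 - t) with hr'
  have hs0 : 0 < √(1 - t) := Real.sqrt_pos.2 (by linarith)
  have hs1 : √(1 - t) < 1 := by
    rw [Real.sqrt_lt' one_pos]; linarith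
  have hr'0 : 0 < r' := by positivity
  have hr'r : r' < r := by nlinarith
  have hsub : ∀ x ∈ closedBall x₀ r', ‖x - x₀‖ < r := fun x hx => by
    rw [← dist_eq_norm]; exact lt_of_le_of_lt hx hr'r
  have hmain := hsol.le_of_supersolution (w := ballBarrier D k r x₀) hA hu hbd hp hq
    (isCompact_closedBall x₀ r')
    (fun h => h0' (closedBall_subset_closedBall hr'r.le h))
    (fun x hx => contDiffAt_ballBarrier hr (hsub x hx))
    (fun x hx => mul_pos hD (Real.rpow_pos_of_pos (one_sub_div_pos hr (hsub x hx)) _))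
    (fun x hx => ballBarrier_supersolution hr hD hk hq hkp hkq hDle (hsub x hx))
    (fun x hx hxA hxi => by
      have hxe : ‖x - x₀‖ = r' := by
        rw [← dist_eq_norm]
        refine le_antisymm hx (not_lt.1 fun h => hxi ?_)
        exact ball_subset_interior_closedBall h
      have h1 : ballBarrier D k r x₀ x = D * t ^ (-k) := by
        rw [ballBarrier, hxe, hr', mul_pow, Real.sq_sqrt (by linarith),
          mul_div_cancel_left₀ _ (by positivity), sub_sub_cancel]
      rw [h1]
      exact (hB x ⟨closedBall_subset_closedBall hr'r.le hx, subset_closure hxA⟩).trans htB)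
    x₀ (mem_closedBall_self hr'0.le) hx₀
  simpa [ballBarrier] using hmain

/-! ### The barrier outside a small ball about the origin. -/

/-- The barrier `C (|x| - δ)^(-α) + ε` outside the ball of radius `δ` about the origin. -/
noncomputable def exteriorBarrier {N : ℕ} (C α δ ε : ℝ) (x : E^ N) : ℝ :=
  C * (‖x‖ - δ) ^ (-α) + ε

section ExteriorBarrier

variable {N : ℕ} {C α δ ε : ℝ} {x : E^ N}

theorem exteriorBarrier_eq_radial :
    exteriorBarrier (N := N) C α δ ε = fun y => C * (√(‖y - 0‖ ^ 2) - δ) ^ (-α) + ε := by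
  funext y
  simp [exteriorBarrier, Real.sqrt_sq]

theorem hasDerivAt_sqrt_sub_rpow (b : ℝ) {s : ℝ} (hs : 0 < s) (hδ : δ < √s) :
    HasDerivAt (fun s => (√s - δ) ^ b) (b * (√s - δ) ^ (b - 1) / (2 * √s)) s := by
  have h1 : HasDerivAt (fun s : ℝ => √s - δ) (1 / (2 * √s)) s :=
    (Real.hasDerivAt_sqrt hs.ne').sub_const δ
  refine (h1.rpow_const (p := b) (Or.inl (by linarith))).congr_deriv ?_
  ring

theorem contDiffAt_sqrt_sub_rpow {s : ℝ} (hs : 0 < s) (hδ : δ < √s) :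
    ContDiffAt ℝ 2 (fun s => C * (√s - δ) ^ (-α) + ε) s :=
  (contDiffAt_const.mul (((Real.contDiffAt_sqrt hs.ne').sub contDiffAt_const).rpow_const_of_ne
    (by linarith))).add contDiffAt_const

theorem hasDerivAt_exteriorBarrier_profile {s : ℝ} (hs : 0 < s) (hδ : δ < √s) :
    HasDerivAt (fun s => C * (√s - δ) ^ (-α) + ε)
      (-(C * α / 2) * ((√s - δ) ^ (-α - 1) * (√s)⁻¹)) s := by
  refine (((hasDerivAt_sqrt_sub_rpow (-α) hs hδ).const_mul C).add_const ε).congr_deriv ?_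
  have : 0 < √s := Real.sqrt_pos.2 hs
  field_simp

theorem norm_gradient_exteriorBarrier (hC : 0 ≤ C) (hα : 0 ≤ α) (hδ : 0 < δ) (hx : δ < ‖x‖) :
    ‖∇ (exteriorBarrier C α δ ε) x‖ = C * α * (‖x‖ - δ) ^ (-α - 1) := by
  have hx0 : 0 < ‖x‖ := hδ.trans hx
  have hpos : 0 ≤ (‖x‖ - δ) ^ (-α - 1) := Real.rpow_nonneg (by linarith) _
  rw [exteriorBarrier_eq_radial, gradient_radial (h := fun s => C * (√s - δ) ^ (-α) + ε)
    (hasDerivAt_exteriorBarrier_profile (by rw [sub_zero]; positivity) (by simpa using hx))]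
  simp only [sub_zero, Real.sqrt_sq hx0.le, norm_smul, norm_mul, norm_neg, norm_inv, norm_div,
    Real.norm_of_nonneg hpos, Real.norm_of_nonneg hC, Real.norm_of_nonneg hα, norm_norm]
  norm_num
  field_simp

/-- The profile decreases in `|x|`, so the term of the radial Laplacian with factor `(N - 1) / |x|`
is nonpositive and can be dropped. This keeps `N` out of `gradientConst`. -/
theorem laplacian_exteriorBarrier_le (hN : 1 ≤ N) (hC : 0 ≤ C) (hα : 0 ≤ α) (hδ : 0 < δ)
    (hx : δ < ‖x‖) :
    Δ (exteriorBarrier C α δ ε) x ≤ C * α * (α + 1) * (‖x‖ - δ) ^ (-α - 2) := by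
  have hx0 : 0 < ‖x‖ := hδ.trans hx
  have hs : 0 < ‖x - 0‖ ^ 2 := by rw [sub_zero]; positivity
  have hδs : δ < √(‖x - 0‖ ^ 2) := by simpa using hx
  have hinv : HasDerivAt (fun s => (√s)⁻¹)
      (-(1 / (2 * √(‖x - 0‖ ^ 2))) / √(‖x - 0‖ ^ 2) ^ 2) (‖x - 0‖ ^ 2) :=
    (Real.hasDerivAt_sqrt hs.ne').fun_inv (Real.sqrt_pos.2 hs).ne'
  rw [exteriorBarrier_eq_radial, laplacian_radial (h := fun s => C * (√s - δ) ^ (-α) + ε)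
    (h₁ := fun s => -(C * α / 2) * ((√s - δ) ^ (-α - 1) * (√s)⁻¹))
    (contDiffAt_sqrt_sub_rpow hs hδs)
    (by
      filter_upwards [eventually_gt_nhds hs, continuousAt_const.eventually_lt
        Real.continuous_sqrt.continuousAt hδs] with s h1 h2
      exact hasDerivAt_exteriorBarrier_profile h1 h2)
    (((hasDerivAt_sqrt_sub_rpow (-α - 1) hs hδs).fun_mul hinv).const_mul _)]
  simp only [sub_zero, Real.sqrt_sq hx0.le]
  rw [show -α - 1 - 1 = -α - 2 by ring]
  have hP : 0 ≤ C * α * (‖x‖ - δ) ^ (-α - 1) / ‖x‖ :=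
    div_nonneg (mul_nonneg (mul_nonneg hC hα) (Real.rpow_nonneg (by linarith) _)) hx0.le
  have hN' : (1 : ℝ) ≤ N := by exact_mod_cast hN
  have key : 4 * (-(C * α / 2) * ((-α - 1) * (‖x‖ - δ) ^ (-α - 2) / (2 * ‖x‖) * ‖x‖⁻¹ +
      (‖x‖ - δ) ^ (-α - 1) * (-(1 / (2 * ‖x‖)) / ‖x‖ ^ 2))) * ‖x‖ ^ 2 +
      2 * N * (-(C * α / 2) * ((‖x‖ - δ) ^ (-α - 1) * ‖x‖⁻¹)) =
      C * α * (α + 1) * (‖x‖ - δ) ^ (-α - 2) -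
        (N - 1) * (C * α * (‖x‖ - δ) ^ (-α - 1) / ‖x‖) := by
    field_simp
    ring
  rw [key]
  nlinarith

/-- The relation `hαq` gives the Laplacian bound and the gradient term the same order `(|x| -
δ)^(-α-2)`, so only coefficients are compared. The absorption term enters through its sign alone. -/
theorem exteriorBarrier_supersolution {p q M : ℝ} (hN : 1 ≤ N) (hC : 0 < C) (hα : 0 < α)
    (hδ : 0 < δ) (hε : 0 ≤ ε) (hαq : (α + 1) * q = α + 2)
    (hCM : C * α * (α + 1) ≤ -M * (C * α) ^ q) (hx : δ < ‖x‖) :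
    Δ (exteriorBarrier C α δ ε) x ≤
      exteriorBarrier C α δ ε x ^ p - M * ‖∇ (exteriorBarrier C α δ ε) x‖ ^ q := by
  have hpos : 0 < ‖x‖ - δ := by linarith
  have h1 := laplacian_exteriorBarrier_le (ε := ε) hN hC.le hα.le hδ hx
  have h2 : 0 ≤ exteriorBarrier C α δ ε x ^ p := by
    unfold exteriorBarrier
    positivity
  rw [norm_gradient_exteriorBarrier hC.le hα.le hδ hx, Real.mul_rpow (by positivity)
    (by positivity), ← Real.rpow_mul hpos.le,
    show (-α - 1) * q = -α - 2 by linarith]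
  have h3 := mul_le_mul_of_nonneg_right hCM (Real.rpow_nonneg hpos.le (-α - 2))
  linarith

end ExteriorBarrier

/-- Upper bound driven by the gradient term alone, for a solution that is bounded away from the
origin and has nonpositive limit superior at infinity, both expressed by a power bound. -/
theorem SolvesInDistributions.le_of_exterior {N : ℕ} {p q M C α c β : ℝ} {A : Set (E^ N)}
    {u : (E^ N) → ℝ} (hsol : SolvesInDistributions p q M A u) (hA : IsOpen A)
    (hu : IsC1OffOrigin A u) (hbd : ∀ x ∈ frontier A \ {0}, u x = 0)
    (hN : 1 ≤ N) (hp : 1 < p) (hq : 0 ≤ q) (hC : 0 < C) (hα : 0 < α)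
    (hαq : (α + 1) * q = α + 2) (hCM : C * α * (α + 1) ≤ -M * (C * α) ^ q)
    (hc : 0 ≤ c) (hβ : 0 < β) (hdecay : ∀ x ∈ A, u x ≤ c * ‖x‖ ^ (-β))
    {x₀ : E^ N} (hx₀ : x₀ ∈ A) (hx₀0 : x₀ ≠ 0) : u x₀ ≤ C * ‖x₀‖ ^ (-α) := by
  have hR : 0 < ‖x₀‖ := norm_pos_iff.2 hx₀0
  -- A single `δ` is both the radius of the hole and the additive constant. Comparison runs on `δ +
  -- τ ≤ |x| ≤ R`: `τ` makes the singular part beat the decay bound on the inner sphere, and `R`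
  -- makes that bound at most `δ` on the outer one.
  have hbound : ∀ δ, 0 < δ → δ < ‖x₀‖ → u x₀ ≤ C * (‖x₀‖ - δ) ^ (-α) + δ := by
    intro δ hδ hδx
    obtain ⟨τ, hτ0, hτ, hτB⟩ := exists_lt_le_mul_rpow_neg hα hC (c * δ ^ (-β)) (sub_pos.2 hδx)
    obtain ⟨R, hR1, hR2⟩ : ∃ R, ‖x₀‖ < R ∧ c * R ^ (-β) ≤ δ := by
      have h1 : Tendsto (fun R : ℝ => c * R ^ (-β)) atTop (𝓝 (c * 0)) :=
        (tendsto_rpow_neg_atTop hβ).const_mul c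
      rw [mul_zero] at h1
      exact ((eventually_gt_atTop _).and
        ((h1.eventually (eventually_le_nhds hδ)))).exists
    have hmem : ∀ x : E^ N, x ∈ closedBall (0 : E^ N) R \ ball 0 (δ + τ) ↔
        ‖x‖ ≤ R ∧ δ + τ ≤ ‖x‖ := fun x => by simp
    have hgt : ∀ x ∈ closedBall (0 : E^ N) R \ ball 0 (δ + τ), δ < ‖x‖ := fun x hx => by
      linarith [((hmem x).1 hx).2]
    refine hsol.le_of_supersolution (w := exteriorBarrier C α δ δ) hA hu hbd hp hq
      ((isCompact_closedBall (0 : E^ N) R).diff isOpen_ball)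
      (fun h => ?_) (fun x hx => ?_) (fun x hx => ?_)
      (fun x hx => exteriorBarrier_supersolution hN hC hα hδ hδ.le hαq hCM (hgt x hx))
      (fun x hx hxA hxi => ?_) x₀ ((hmem x₀).2 ⟨hR1.le, by linarith⟩) hx₀
    · have := hgt 0 h
      rw [norm_zero] at this
      linarith
    · rw [exteriorBarrier_eq_radial]
      have h1 := hgt x hx
      have h2 : 0 < ‖x‖ := hδ.trans h1
      exact contDiffAt_radial (h := fun s => C * (√s - δ) ^ (-α) + δ)
        (contDiffAt_sqrt_sub_rpow (by rw [sub_zero]; positivity) (by simpa using h1))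
    · have h1 : 0 < ‖x‖ - δ := sub_pos.2 (hgt x hx)
      unfold exteriorBarrier
      positivity
    · obtain ⟨h1, h2⟩ := (hmem x).1 hx
      have h3 : 0 < ‖x‖ - δ := sub_pos.2 (hgt x hx)
      have h4 : 0 ≤ C * (‖x‖ - δ) ^ (-α) := by positivity
      unfold exteriorBarrier
      rcases eq_or_lt_of_le h2 with h5 | h5
      · have h6 : c * ‖x‖ ^ (-β) ≤ c * δ ^ (-β) :=
          mul_le_mul_of_nonneg_left
            (Real.rpow_le_rpow_of_nonpos hδ (by linarith) (by linarith)) hc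
        rw [← h5] at h6 ⊢
        rw [add_sub_cancel_left]
        have h7 := hdecay x hxA
        rw [← h5] at h7
        linarith
      · have h6 : ‖x‖ = R := by
          refine le_antisymm h1 (not_lt.1 fun h => hxi ?_)
          refine mem_interior.2 ⟨ball 0 R \ closedBall 0 (δ + τ),
            sdiff_subset_sdiff ball_subset_closedBall ball_subset_closedBall,
            isOpen_ball.sdiff isClosed_closedBall, ?_⟩
          simp [h, h5]
        have h7 := hdecay x hxA
        rw [h6] at h7 h4 ⊢
        linarith
  have hlim : Tendsto (fun δ : ℝ => C * (‖x₀‖ - δ) ^ (-α) + δ) (𝓝[>] 0)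
      (𝓝 (C * ‖x₀‖ ^ (-α))) := by
    have : ContinuousAt (fun δ : ℝ => C * (‖x₀‖ - δ) ^ (-α) + δ) 0 := by
      refine (continuousAt_const.mul (ContinuousAt.rpow_const (by fun_prop) (Or.inl ?_))).add
        continuousAt_id
      simpa using hx₀0
    have h := this.tendsto.mono_left (nhdsWithin_le_nhds (s := Ioi 0))
    simpa using h
  refine ge_of_tendsto hlim ?_
  filter_upwards [self_mem_nhdsWithin,
    eventually_nhdsWithin_of_eventually_nhds (eventually_lt_nhds hR)] with δ h1 h2
  exact hbound δ h1 h2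

/-! ### Constants and the three upper bounds. -/

/-- The constant in the bound by the absorption term alone. -/
noncomputable def absorptionConst (N : ℕ) (p : ℝ) : ℝ :=
  (1 + 4 * (2 * |2 / (p - 1)| * N + 4 * |2 / (p - 1)| * (|2 / (p - 1)| + 1))) ^ (1 / (p - 1))

/-- The constant in the bound by the gradient term alone. -/
noncomputable def gradientConst (q : ℝ) : ℝ :=
  (|(2 - q) / (q - 1)| + 1) ^ (1 / (q - 1)) * (1 + 1 / |(2 - q) / (q - 1)|)

/-- The exponent of the ball barrier used when the gradient term is a source. -/
noncomputable def sourceExponent (p q : ℝ) : ℝ := max |2 / (p - 1)| |q / (p - q)|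

/-- The constant in the bound when the gradient term is a source. -/
noncomputable def sourceConst (N : ℕ) (p q : ℝ) : ℝ :=
  (1 + 4 * (2 * sourceExponent p q * N + 4 * sourceExponent p q * (sourceExponent p q + 1)) +
    (4 * sourceExponent p q) ^ q) ^ (1 / (p - q))

theorem absorptionConst_pos (N : ℕ) (p : ℝ) : 0 < absorptionConst N p := by
  unfold absorptionConst
  positivity

/-- The absolute values give positivity for every real `q`; where the inner quotient vanishes, `1 /
0 = 0` leaves the last factor equal to `1`. -/
theorem gradientConst_pos (q : ℝ) : 0 < gradientConst q := by
  unfold gradientConst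
  positivity

theorem sourceExponent_nonneg (p q : ℝ) : 0 ≤ sourceExponent p q :=
  (abs_nonneg _).trans (le_max_left _ _)

theorem sourceConst_pos (N : ℕ) (p q : ℝ) : 0 < sourceConst N p q := by
  have := sourceExponent_nonneg p q
  unfold sourceConst
  positivity

section Bounds

variable {N : ℕ} {p q M : ℝ} {A : Set (E^ N)} {u : (E^ N) → ℝ} {x : E^ N}

theorem SolvesInDistributions.le_absorption (hsol : SolvesInDistributions p q M A u)
    (hA : IsOpen A) (hu : IsC1OffOrigin A u) (hbd : ∀ x ∈ frontier A \ {0}, u x = 0)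
    (hp : 1 < p) (hq : 0 ≤ q) (hM : M ≤ 0) (hx : x ∈ A) (hx0 : x ≠ 0) :
    u x ≤ absorptionConst N p * ‖x‖ ^ (-(2 / (p - 1))) := by
  have hp1 : 0 < p - 1 := by linarith
  have hR : 0 < ‖x‖ := norm_pos_iff.2 hx0
  have hk : 0 < 2 / (p - 1) := by positivity
  have hkp : 2 / (p - 1) * p = 2 / (p - 1) + 2 := by field_simp; ring
  have hc := absorptionConst_pos N p
  have hcp : absorptionConst N p ^ (p - 1) =
      1 + 4 * (2 * (2 / (p - 1)) * N + 4 * (2 / (p - 1)) * (2 / (p - 1) + 1)) := by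
    rw [absorptionConst, abs_of_pos hk, ← Real.rpow_mul (by positivity),
      one_div_mul_cancel hp1.ne', Real.rpow_one]
  set k := 2 / (p - 1) with hkdef
  set D := absorptionConst N p * ‖x‖ ^ (-k) with hD
  have hD0 : 0 < D := by positivity
  have hDp : D ^ p = D * (absorptionConst N p ^ (p - 1) / ‖x‖ ^ 2) := by
    rw [show D ^ p = D * D ^ (p - 1) by
      rw [← Real.rpow_one_add' hD0.le (by linarith), add_sub_cancel]]
    congr 1
    rw [hD, Real.mul_rpow hc.le (by positivity), ← Real.rpow_mul hR.le,
      show -k * (p - 1) = -(2 : ℕ) by rw [hkdef]; field_simp; norm_num, Real.rpow_neg hR.le,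
      Real.rpow_natCast, div_eq_mul_inv]
  -- Half the distance to the origin keeps the closed ball away from it; the resulting `r² = |x|² /
  -- 4` is the source of the factor `4` in `absorptionConst`.
  refine hsol.le_of_ball hA hu hbd hp hq (k := k) (r := ‖x‖ / 2) (by positivity) hD0 hk hkp.ge
    (fun h => absurd hM h.not_ge) ?_ hx (by linarith)
  rw [max_eq_right hM, zero_mul, add_zero, hDp, hcp]
  have h1 : (2 * k * N + 4 * k * (k + 1)) * D / (‖x‖ / 2) ^ 2 =
      D * ((4 * (2 * k * N + 4 * k * (k + 1))) / ‖x‖ ^ 2) := by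
    field_simp
    norm_num
  rw [h1]
  gcongr
  linarith

/-- The maximum `X` satisfies `|x|^(-2) ≤ X^(p-1)` and `M |x|^(-q) ≤ X^(p-q)`. For the barrier
height `c X`, both terms to be absorbed are then multiples of `c^q X^p`, using `c ≥ 1`, and
`c^(p-q)` is defined to exceed the sum of their coefficients. -/
theorem SolvesInDistributions.le_source (hsol : SolvesInDistributions p q M A u)
    (hA : IsOpen A) (hu : IsC1OffOrigin A u) (hbd : ∀ x ∈ frontier A \ {0}, u x = 0)
    (hq : 1 < q) (hqp : q < p) (hM : 0 < M) (hx : x ∈ A) (hx0 : x ≠ 0) :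
    u x ≤ sourceConst N p q *
      max (M ^ (1 / (p - q)) * ‖x‖ ^ (-(q / (p - q)))) (‖x‖ ^ (-(2 / (p - 1)))) := by
  have hp : 1 < p := hq.trans hqp
  have hp1 : 0 < p - 1 := by linarith
  have hpq : 0 < p - q := by linarith
  have hq0 : 0 < q := by linarith
  have hR : 0 < ‖x‖ := norm_pos_iff.2 hx0
  have hk1 : 2 / (p - 1) ≤ sourceExponent p q := (le_abs_self _).trans (le_max_left _ _)
  have hk2 : q / (p - q) ≤ sourceExponent p q := (le_abs_self _).trans (le_max_right _ _)
  have hcp : sourceConst N p q ^ (p - q) = 1 + 4 * (2 * sourceExponent p q * N +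
      4 * sourceExponent p q * (sourceExponent p q + 1)) + (4 * sourceExponent p q) ^ q := by
    have := sourceExponent_nonneg p q
    rw [sourceConst, ← Real.rpow_mul (by positivity), one_div_mul_cancel hpq.ne', Real.rpow_one]
  have hc1 : 1 ≤ sourceConst N p q := by
    have := sourceExponent_nonneg p q
    refine Real.one_le_rpow ?_ (by positivity)
    have h1 : 0 ≤ 4 * (2 * sourceExponent p q * N +
      4 * sourceExponent p q * (sourceExponent p q + 1)) := by positivity
    have h2 : 0 ≤ (4 * sourceExponent p q) ^ q := by positivity
    linarith
  set c := sourceConst N p q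
  set k := sourceExponent p q
  have hc : 0 < c := one_pos.trans_le hc1
  have hk : 0 < k := lt_of_lt_of_le (by positivity) hk1
  set X := max (M ^ (1 / (p - q)) * ‖x‖ ^ (-(q / (p - q)))) (‖x‖ ^ (-(2 / (p - 1)))) with hX
  have hX0 : 0 < X := lt_max_of_lt_right (by positivity)
  have hX1 : (‖x‖ ^ 2)⁻¹ ≤ X ^ (p - 1) := by
    calc (‖x‖ ^ 2)⁻¹ = (‖x‖ ^ (-(2 / (p - 1)))) ^ (p - 1) := by
          rw [← Real.rpow_mul hR.le, show -(2 / (p - 1)) * (p - 1) = -(2 : ℕ) by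
            field_simp; norm_num, Real.rpow_neg hR.le, Real.rpow_natCast]
      _ ≤ _ := Real.rpow_le_rpow (by positivity) (le_max_right _ _) hp1.le
  have hX2 : M * (‖x‖ ^ q)⁻¹ ≤ X ^ (p - q) := by
    calc M * (‖x‖ ^ q)⁻¹ = (M ^ (1 / (p - q)) * ‖x‖ ^ (-(q / (p - q)))) ^ (p - q) := by
          rw [Real.mul_rpow (by positivity) (by positivity), ← Real.rpow_mul hR.le,
            ← Real.rpow_mul hM.le, one_div_mul_cancel hpq.ne', Real.rpow_one,
            show -(q / (p - q)) * (p - q) = -q by field_simp, Real.rpow_neg hR.le]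
      _ ≤ _ := Real.rpow_le_rpow (by positivity) (le_max_left _ _) hpq.le
  refine hsol.le_of_ball hA hu hbd hp hq0.le (k := k) (r := ‖x‖ / 2) (by positivity)
    (by positivity) hk ?_ (fun _ => ?_) ?_ hx (by linarith)
  · rw [div_le_iff₀ hp1] at hk1
    linarith
  · rw [div_le_iff₀ hpq] at hk2
    linarith
  · rw [max_eq_left hM.le]
    set K := 2 * k * N + 4 * k * (k + 1) with hK
    have hK0 : 0 ≤ K := by positivity
    have hXp1 : X ^ p = X * X ^ (p - 1) := by
      rw [← Real.rpow_one_add' hX0.le (by linarith), add_sub_cancel]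
    have hXp2 : X ^ p = X ^ q * X ^ (p - q) := by
      rw [← Real.rpow_add hX0, add_sub_cancel]
    have hcpq : c ^ p = c ^ q * c ^ (p - q) := by
      rw [← Real.rpow_add hc, add_sub_cancel]
    have hccq : c ≤ c ^ q := by
      simpa using Real.rpow_le_rpow_of_exponent_le hc1 hq.le
    have h1 : K * (c * X) / (‖x‖ / 2) ^ 2 ≤ 4 * K * c ^ q * X ^ p := by
      calc K * (c * X) / (‖x‖ / 2) ^ 2 = 4 * K * c * (X * (‖x‖ ^ 2)⁻¹) := by
            field_simp
            norm_num
        _ ≤ 4 * K * c ^ q * (X * X ^ (p - 1)) := by gcongr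
        _ = _ := by rw [hXp1]
    have h2 : M * (2 * k * (c * X) / (‖x‖ / 2)) ^ q ≤ (4 * k) ^ q * c ^ q * X ^ p := by
      calc M * (2 * k * (c * X) / (‖x‖ / 2)) ^ q = M * (4 * k * (c * (X * ‖x‖⁻¹))) ^ q := by
            congr 2
            field_simp
            norm_num
        _ = (4 * k) ^ q * c ^ q * (X ^ q * (M * (‖x‖ ^ q)⁻¹)) := by
            rw [Real.mul_rpow (by positivity) (by positivity), Real.mul_rpow hc.le
              (by positivity), Real.mul_rpow hX0.le (by positivity), Real.inv_rpow hR.le]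
            ring
        _ ≤ (4 * k) ^ q * c ^ q * (X ^ q * X ^ (p - q)) := by gcongr
        _ = _ := by rw [hXp2]
    have h3 : (c * X) ^ p = c ^ q * (1 + 4 * K + (4 * k) ^ q) * X ^ p := by
      rw [Real.mul_rpow hc.le hX0.le, hcpq, hcp]
    have h4 : 0 ≤ c ^ q * X ^ p := by positivity
    rw [h3]
    linarith

/-- The exterior barrier needs `(C α)^(q-1) ≥ (α + 1) / |M|`, which fixes the power of `|M|`. The
factor `1 + 1 / α` in `gradientConst` more than supplies the `1 / α` required. The decay at infinity
comes from `le_absorption`. -/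
theorem SolvesInDistributions.le_gradient (hsol : SolvesInDistributions p q M A u)
    (hA : IsOpen A) (hu : IsC1OffOrigin A u) (hbd : ∀ x ∈ frontier A \ {0}, u x = 0)
    (hp : 1 < p) (hq : 1 < q) (hq2 : q < 2) (hM : M < 0) (h0 : 0 ∉ A)
    (hx : x ∈ A) :
    u x ≤ gradientConst q * |M| ^ (-(1 / (q - 1))) * ‖x‖ ^ (-((2 - q) / (q - 1))) := by
  have hq1 : 0 < q - 1 := by linarith
  have hq0 : 0 < q := by linarith
  have hα : 0 < (2 - q) / (q - 1) := div_pos (by linarith) hq1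
  have hne : ∀ y ∈ A, y ≠ 0 := fun y hy h => h0 (h ▸ hy)
  have hx0 := hne x hx
  have hN : 1 ≤ N := by
    rcases Nat.eq_zero_or_pos N with rfl | h
    · exact absurd (Subsingleton.elim x 0) hx0
    · exact h
  have hαq : ((2 - q) / (q - 1) + 1) * q = (2 - q) / (q - 1) + 2 := by
    field_simp
    ring
  have hM' : 0 < |M| := abs_pos.2 hM.ne
  have hc := gradientConst_pos q
  have hcα : ((2 - q) / (q - 1) + 1) ^ (1 / (q - 1)) ≤
      gradientConst q * ((2 - q) / (q - 1)) := by
    rw [gradientConst, abs_of_pos hα, mul_assoc, add_mul, one_mul, one_div_mul_cancel hα.ne']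
    exact le_mul_of_one_le_right (by positivity) (by linarith)
  set α := (2 - q) / (q - 1)
  set C := gradientConst q * |M| ^ (-(1 / (q - 1))) with hC
  have hC0 : 0 < C := by positivity
  refine hsol.le_of_exterior hA hu hbd hN hp hq0.le hC0 hα hαq ?_
    (absorptionConst_pos N p).le (β := 2 / (p - 1)) (div_pos two_pos (by linarith))
    (fun y hy => hsol.le_absorption hA hu hbd hp hq0.le hM.le hy (hne y hy)) hx hx0
  have h1 : (α + 1) / |M| ≤ (C * α) ^ (q - 1) := by
    calc (α + 1) / |M| =
          ((α + 1) ^ (1 / (q - 1)) * |M| ^ (-(1 / (q - 1)))) ^ (q - 1) := by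
          rw [Real.mul_rpow (by positivity) (by positivity), ← Real.rpow_mul (by positivity),
            ← Real.rpow_mul hM'.le, neg_mul, one_div_mul_cancel hq1.ne', Real.rpow_one,
            Real.rpow_neg_one, div_eq_mul_inv]
      _ ≤ (gradientConst q * α * |M| ^ (-(1 / (q - 1)))) ^ (q - 1) := by gcongr
      _ = _ := by rw [hC]; ring_nf
  have h2 : (C * α) ^ q = C * α * (C * α) ^ (q - 1) := by
    rw [← Real.rpow_one_add' (by positivity) (by linarith), add_sub_cancel]
  rw [div_le_iff₀ hM', abs_of_neg hM] at h1
  rw [h2]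
  calc C * α * (α + 1) ≤ C * α * ((C * α) ^ (q - 1) * -M) := by gcongr
    _ = _ := by ring

end Bounds

/-! ### Assembly of the estimates. -/

theorem theorem2p1 (N : ℕ) :
    ∃ (c₅ : ℝ → ℝ → ℝ) (c₆ c₇ : ℝ → ℝ),
      (∀ p q, 0 < c₅ p q) ∧ (∀ q, 0 < c₆ q) ∧ (∀ p, 0 < c₇ p) ∧
      ∀ (p q M : ℝ), 1 < q → q < min p 2 →
      ∀ (A : Set (EuclideanSpace ℝ (Fin N))), IsOpen A → IsConnected A →
        (0 : EuclideanSpace ℝ (Fin N)) ∈ frontier A →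
      ∀ (u : EuclideanSpace ℝ (Fin N) → ℝ), IsC1OffOrigin A u →
        SolvesInDistributions p q M A u →
        (∀ x ∈ frontier A \ {0}, u x = 0) →
        (0 < M → ∀ x ∈ A,
          max (u x) 0 ≤ c₅ p q *
            max (M ^ (1 / (p - q)) * ‖x‖ ^ (-(q / (p - q)))) (‖x‖ ^ (-(2 / (p - 1))))) ∧
        (M < 0 → ∀ x ∈ A,
          max (u x) 0 ≤
            min (c₆ q * |M| ^ (-(1 / (q - 1))) * ‖x‖ ^ (-((2 - q) / (q - 1))))
              (c₇ p * ‖x‖ ^ (-(2 / (p - 1))))) ∧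
        (M = 0 → ∀ x ∈ A,
          max (u x) 0 ≤ c₇ p * ‖x‖ ^ (-(2 / (p - 1)))) := by
  refine ⟨sourceConst N, gradientConst, absorptionConst N, sourceConst_pos N, gradientConst_pos,
    absorptionConst_pos N, ?_⟩
  intro p q M hq hqm A hA _ h0 u hu hsol hbd
  obtain ⟨hqp, hq2⟩ := lt_min_iff.1 hqm
  have hp : 1 < p := hq.trans hqp
  have hq0 : 0 ≤ q := by linarith
  have hne : (0 : EuclideanSpace ℝ (Fin N)) ∉ A := fun h => h0.2 (by rwa [hA.interior_eq])
  have hx0 : ∀ x ∈ A, x ≠ 0 := fun x hx h => hne (h ▸ hx)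
  have hc₅ := sourceConst_pos N p q
  have hc₆ := gradientConst_pos q
  have hc₇ := absorptionConst_pos N p
  refine ⟨fun hM x hx => max_le (hsol.le_source hA hu hbd hq hqp hM hx (hx0 x hx)) ?_,
    fun hM x hx => le_min
      (max_le (hsol.le_gradient hA hu hbd hp hq hq2 hM hne hx) (by positivity))
      (max_le (hsol.le_absorption hA hu hbd hp hq0 hM.le hx (hx0 x hx)) (by positivity)),
    fun hM x hx =>
      max_le (hsol.le_absorption hA hu hbd hp hq0 hM.le hx (hx0 x hx)) (by positivity)⟩
  exact mul_nonneg hc₅.le (le_max_of_le_right (by positivity))
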